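/- **Proposition (Expectation of occupation times).** Let $\lambda>0$, $\sigma>0$, $T>0$, and let $(X_t)_{t\in[0,T]}$ be a centered Ornstein–Uhlenbeck process on a probability space $(\Omega,\mathcal F,\mathbb P)$, that is, a process with almost surely continuous paths satisfying $$dX_t=-\lambda X_t\,dt+\sigma\,dW_t,\qquad X_0=0,$$ for a standard Brownian motion $(W_t)_{t\ge 0}$. This means that, almost surely, $X_0=0$ and $X_t=-\lambda\int_0^t X_s\,ds+\sigma W_t$ for all $t\in[0,T]$. Let $a,b\in[-\infty,+\infty]$ with $a\le b$, and let $[a,b]$ denote the set of real numbers $x$ with $a\le x\le b$. Then the occupation time $$M_{T,[a,b]}(X):=\int_0^T\mathbf 1_{[a,b]}(X_t)\,dt$$ is almost surely well defined and integrable, the integral on the right-hand side below exists, and $$\mathbb E\bigl[M_{T,[a,b]}(X)\bigr]=\frac12\int_0^T\left[\operatorname{erf}\!\left(\frac{\alpha b}{\sqrt{1-e^{-2\lambda t}}}\right)-\operatorname{erf}\!\left(\frac{\alpha a}{\sqrt{1-e^{-2\lambda t}}}\right)\right]dt,\qquad \alpha=\frac{\sqrt\lambda}{\sigma},$$ where $\operatorname{erf}(x)=\frac{2}{\sqrt\pi}\int_0^x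 e^{-s^2}\,ds$ for $x\in\mathbb R$, and $\operatorname{erf}(\pm\infty)=\pm1$. -/

import Mathlib

open MeasureTheory ProbabilityTheory
open scoped NNReal

/-- The error function `erf x = (2 / √π) ∫₀ˣ exp (-s²) ds`. -/
noncomputable def erf (x : ℝ) : ℝ :=
  2 / Real.sqrt Real.pi * ∫ s in (0 : ℝ)..x, Real.exp (-s ^ 2)

/-- The error function on the extended real line, with its limit values
`erf (+∞) = 1` and `erf (-∞) = -1`. -/
noncomputable def erfExt (x : EReal) : ℝ :=
  if x = ⊤ then 1 else if x = ⊥ then -1 else erf x.toReal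

/-- `X` is a centered Ornstein–Uhlenbeck process on `[0, T]` with stiffness `lam` and diffusion
parameter `σ`, driven by the standard Brownian motion `W`: a process with almost surely continuous
paths on `[0, T]` that solves `dX_t = -lam X_t dt + σ dW_t`, `X_0 = 0`. Since `σ` is constant, the
stochastic integral `∫₀ᵗ σ dW_s` is `σ W_t`, and the equation is, almost surely, the integral
equation below. Only the values `X t` with `t ∈ [0, T]` matter. -/
structure IsCenteredOrnsteinUhlenbeck {Ω : Type*} [MeasurableSpace Ω] (lam σ T : ℝ)
    (W : ℝ≥0 → Ω → ℝ) (X : ℝ → Ω → ℝ) (P : Measure Ω) : Prop where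
  isBrownian : IsBrownianReal W P
  initial : ∀ᵐ ω ∂P, X 0 ω = 0
  continuousOn : ∀ᵐ ω ∂P, ContinuousOn (fun t => X t ω) (Set.Icc 0 T)
  sde : ∀ᵐ ω ∂P, ∀ t ∈ Set.Icc (0 : ℝ) T,
    X t ω = X 0 ω + (∫ s in (0 : ℝ)..t, -lam * X s ω) + σ * W t.toNNReal ω

/-- The interval `[a, b] ⊆ ℝ`, with infinite endpoints allowed. -/
def realInterval (a b : EReal) : Set ℝ := {x : ℝ | a ≤ (x : EReal) ∧ (x : EReal) ≤ b}

/-- The occupation time `∫₀ᵀ 1_{[a,b]}(X_t) dt`, a random variable. -/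
noncomputable def occupationTime {Ω : Type*} (T : ℝ) (a b : EReal) (X : ℝ → Ω → ℝ) (ω : Ω) : ℝ :=
  ∫ t in (0 : ℝ)..T, (realInterval a b).indicator (fun _ => (1 : ℝ)) (X t ω)

/-!
The expected occupation time is computed by exchanging expectation and time integral, so that
everything reduces to the one-dimensional marginals of the process.

*Marginals.* On the uniform mesh of `[0, t]` with `n` steps of width `h = t / n`, the explicit Euler
scheme is `S = ∑ k < n, (1 - lam h) ^ (n - 1 - k) σ (W_{(k+1)h} - W_{kh})`. The equation shows that,
along each continuous path, the scheme has a one-step error `o(h)` which is not amplified, so `S`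
tends to `X_t` (`tendsto_euler_of_langevin`). Independence of the Brownian increments makes `S`
centered Gaussian, with a variance that is a geometric sum tending to
`σ² (1 - exp (-2 lam t)) / (2 lam)` (`tendsto_euler_variance`). Gaussian laws are stable under almost
sure limits, which gives the law of `X_t` (`IsCenteredOrnsteinUhlenbeck.hasLaw_eval`) without any
stochastic integral.

*Error function.* The mass of an interval under a centered Gaussian measure is a difference of values
of `erfExt` (`gaussianReal_real_realInterval`).

*Fubini.* Continuity of the paths and measurability of the marginals make `(t, ω) ↦ X t ω` jointly
measurable up to a null set (`aemeasurable_uncurry_of_continuousOn`), so the indicator of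
`X t ω ∈ [a, b]` is integrable on the product space. All the integrability claims and the
exchange of integrals follow from this.
-/

/-! ### The explicit Euler scheme along one path -/

/-- The solution of the recursion `x (k + 1) = q * x k + r k` with `x 0 = 0`, where the inputs `r k`
are read off from `x`. -/
lemma eq_sum_range_pow_mul_sub {R : Type*} [CommRing R] (q : R) (x : ℕ → R) (hx : x 0 = 0)
    (n : ℕ) : x n = ∑ k ∈ Finset.range n, q ^ (n - 1 - k) * (x (k + 1) - q * x k) := by
  induction n with
  | zero => simpa using hx
  | succ n ih =>
    have h : ∀ k ∈ Finset.range n, q ^ (n + 1 - 1 - k) * (x (k + 1) - q * x k)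
        = q * (q ^ (n - 1 - k) * (x (k + 1) - q * x k)) := by
      intro k hk
      have hk' := Finset.mem_range.mp hk
      rw [show n + 1 - 1 - k = (n - 1 - k) + 1 by omega]
      ring
    rw [Finset.sum_range_succ, Finset.sum_congr rfl h, ← Finset.mul_sum, ← ih]
    simp

/-- The explicit Euler scheme for the Langevin equation, driven by the path `w`, converges to the
solution. The one-step error on a mesh of width `h` is the integral of an oscillation of `f`, hence
`o(h)`, and the factor `1 - lam * h ∈ [0, 1]` does not amplify it. -/
lemma tendsto_euler_of_langevin {lam σ T : ℝ} (hlam : 0 < lam) {f w : ℝ → ℝ}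
    (hf : ContinuousOn f (Set.Icc 0 T)) (h0 : f 0 = 0)
    (hfw : ∀ t ∈ Set.Icc (0 : ℝ) T, f t = f 0 + (∫ s in (0 : ℝ)..t, -lam * f s) + σ * w t)
    {t : ℝ} (ht : t ∈ Set.Ioc (0 : ℝ) T) :
    Filter.Tendsto (fun n : ℕ => ∑ k ∈ Finset.range n, (1 - lam * (t / n)) ^ (n - 1 - k) * σ *
      (w (((k + 1 : ℕ) : ℝ) * (t / n)) - w (k * (t / n)))) Filter.atTop (nhds (f t)) := by
  have htpos : 0 < t := ht.1
  have huc := isCompact_Icc.uniformContinuousOn_of_continuous hf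
  rw [Metric.uniformContinuousOn_iff] at huc
  rw [Metric.tendsto_atTop]
  intro ε hε
  obtain ⟨δ, hδ, hδf⟩ := huc (ε / (2 * (lam * t))) (by positivity)
  have hmesh : Filter.Tendsto (fun n : ℕ => t / (n : ℝ)) Filter.atTop (nhds 0) :=
    tendsto_const_div_atTop_nhds_zero_nat t
  have hev : ∀ᶠ n : ℕ in Filter.atTop, t / (n : ℝ) < min δ (1 / lam) ∧ 0 < n :=
    (hmesh.eventually_lt_const (by positivity)).and (Filter.eventually_gt_atTop 0)
  obtain ⟨N, hN⟩ := Filter.eventually_atTop.mp hev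
  refine ⟨N, fun n hn => ?_⟩
  obtain ⟨hlt, hnpos⟩ := hN n hn
  have hn' : (0 : ℝ) < n := by exact_mod_cast hnpos
  set h : ℝ := t / n with hh
  have hpos : 0 < h := by positivity
  have hnh : n * h = t := by rw [hh]; field_simp
  have hhδ : h < δ := hlt.trans_le (min_le_left _ _)
  have hlh : lam * h ≤ 1 := by
    have := (hlt.trans_le (min_le_right _ _)).le
    rw [le_div_iff₀ hlam] at this
    linarith
  have hmem : ∀ k : ℕ, k ≤ n → (k : ℝ) * h ∈ Set.Icc (0 : ℝ) T := by
    intro k hk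
    refine ⟨by positivity, le_trans ?_ ht.2⟩
    rw [← hnh]
    gcongr
  -- The one-step error of the scheme.
  have hstep : ∀ k < n, |(f (((k + 1 : ℕ) : ℝ) * h) - (1 - lam * h) * f (k * h))
      - σ * (w (((k + 1 : ℕ) : ℝ) * h) - w (k * h))| ≤ lam * (ε / (2 * (lam * t))) * h := by
    intro k hk
    have h1 := hmem k hk.le
    have h2 := hmem (k + 1) hk
    have hstep_eq : ((k + 1 : ℕ) : ℝ) * h = k * h + h := by push_cast; ring
    have hle : (k : ℝ) * h ≤ ((k + 1 : ℕ) : ℝ) * h := by rw [hstep_eq]; linarith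
    have hsub : Set.Icc ((k : ℝ) * h) (((k + 1 : ℕ) : ℝ) * h) ⊆ Set.Icc 0 T :=
      Set.Icc_subset_Icc h1.1 h2.2
    have hint : ∀ x y : ℝ, x ∈ Set.Icc 0 T → y ∈ Set.Icc 0 T →
        IntervalIntegrable (fun s => -lam * f s) volume x y := fun x y hx hy =>
      ((hf.mono (Set.uIcc_subset_Icc hx hy)).intervalIntegrable).const_mul _
    have h0mem : (0 : ℝ) ∈ Set.Icc 0 T := ⟨le_rfl, htpos.le.trans ht.2⟩
    have hadj := intervalIntegral.integral_interval_sub_left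
      (hint 0 _ h0mem h2) (hint 0 _ h0mem h1)
    have hconst : ∫ _ in (k * h)..(((k + 1 : ℕ) : ℝ) * h), -lam * f (k * h)
        = -lam * f (k * h) * h := by
      rw [intervalIntegral.integral_const, hstep_eq]
      simp [mul_comm]
    have herr : (f (((k + 1 : ℕ) : ℝ) * h) - (1 - lam * h) * f (k * h))
        - σ * (w (((k + 1 : ℕ) : ℝ) * h) - w (k * h))
        = ∫ s in (k * h)..(((k + 1 : ℕ) : ℝ) * h), (-lam * f s - -lam * f (k * h)) := by
      rw [intervalIntegral.integral_sub (hint _ _ h1 h2) intervalIntegrable_const, hconst, ← hadj]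
      linear_combination hfw _ h2 - hfw _ h1
    rw [herr, ← Real.norm_eq_abs]
    have hb := intervalIntegral.norm_integral_le_of_norm_le_const (a := (k : ℝ) * h)
      (b := ((k + 1 : ℕ) : ℝ) * h) (C := lam * (ε / (2 * (lam * t))))
      (f := fun s => -lam * f s - -lam * f (k * h)) (by
        intro s hs
        rw [Set.uIoc_of_le hle] at hs
        have hs' : s ∈ Set.Icc (0 : ℝ) T := hsub ⟨hs.1.le, hs.2⟩
        have hd : dist s (k * h) < δ := by
          rw [Real.dist_eq, abs_of_pos (by linarith [hs.1])]
          have := hs.2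
          rw [hstep_eq] at this
          linarith
        have := (hδf s hs' _ h1 hd).le
        rw [← mul_sub, norm_mul, norm_neg, Real.norm_of_nonneg hlam.le, ← dist_eq_norm]
        exact mul_le_mul_of_nonneg_left this hlam.le)
    refine hb.trans (le_of_eq ?_)
    rw [hstep_eq, show (k : ℝ) * h + h - k * h = h by ring, abs_of_pos hpos]
  have hdecomp := eq_sum_range_pow_mul_sub (1 - lam * h) (fun k : ℕ => f (k * h))
    (by simpa using h0) n
  simp only [hnh] at hdecomp
  rw [dist_comm, Real.dist_eq]
  nth_rw 1 [hdecomp]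
  rw [← Finset.sum_sub_distrib]
  calc _ ≤ ∑ k ∈ Finset.range n, lam * (ε / (2 * (lam * t))) * h := by
        refine (Finset.abs_sum_le_sum_abs _ _).trans (Finset.sum_le_sum fun k hk => ?_)
        rw [mul_assoc, ← mul_sub, abs_mul]
        have hq : |(1 - lam * h) ^ (n - 1 - k)| ≤ 1 := by
          rw [abs_pow]
          refine pow_le_one₀ (abs_nonneg _) (abs_le.mpr ⟨by linarith, ?_⟩)
          nlinarith
        calc _ ≤ 1 * (lam * (ε / (2 * (lam * t))) * h) :=
              mul_le_mul hq (hstep k (Finset.mem_range.mp hk)) (abs_nonneg _) zero_le_one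
          _ = _ := one_mul _
    _ = ε / 2 := by
        rw [Finset.sum_const, Finset.card_range, nsmul_eq_mul]
        calc (n : ℝ) * (lam * (ε / (2 * (lam * t))) * h)
            = lam * (ε / (2 * (lam * t))) * (n * h) := by ring
          _ = ε / 2 := by rw [hnh]; field_simp
    _ < ε := by linarith

/-- The variance of the Euler scheme converges to that of the Ornstein–Uhlenbeck process. -/
lemma tendsto_euler_variance {lam σ t : ℝ} (hlam : 0 < lam) :
    Filter.Tendsto (fun n : ℕ => ∑ k ∈ Finset.range n,
      ((1 - lam * (t / n)) ^ (n - 1 - k) * σ) ^ 2 * (t / n)) Filter.atTop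
      (nhds (σ ^ 2 * (1 - Real.exp (-2 * lam * t)) / (2 * lam))) := by
  by_cases ht : t = 0
  · simp [ht]
  have hmesh : Filter.Tendsto (fun n : ℕ => lam * (t / (n : ℝ))) Filter.atTop (nhds 0) := by
    simpa using (tendsto_const_div_atTop_nhds_zero_nat t).const_mul lam
  have hpow : Filter.Tendsto (fun n : ℕ => (1 - lam * (t / (n : ℝ))) ^ n) Filter.atTop
      (nhds (Real.exp (-(lam * t)))) := by
    refine (Real.tendsto_one_add_div_pow_exp (-(lam * t))).congr fun n => ?_
    congr 1
    ring
  have hlim : Filter.Tendsto (fun n : ℕ => σ ^ 2 * (1 - ((1 - lam * (t / (n : ℝ))) ^ n) ^ 2)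
      / (lam * (2 - lam * (t / (n : ℝ))))) Filter.atTop
      (nhds (σ ^ 2 * (1 - (Real.exp (-(lam * t))) ^ 2) / (lam * (2 - 0)))) :=
    ((tendsto_const_nhds.sub (hpow.pow 2)).const_mul _).div
      ((tendsto_const_nhds.sub hmesh).const_mul _) (by simp [hlam.ne'])
  have hval : σ ^ 2 * (1 - (Real.exp (-(lam * t))) ^ 2) / (lam * (2 - 0))
      = σ ^ 2 * (1 - Real.exp (-2 * lam * t)) / (2 * lam) := by
    rw [← Real.exp_nat_mul]
    congr 1
    · congr 3
      push_cast
      ring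
    · ring
  rw [hval] at hlim
  refine hlim.congr' ?_
  filter_upwards [hmesh.eventually_lt_const (by norm_num : (0 : ℝ) < 2),
    Filter.eventually_gt_atTop 0] with n hn hn0
  have hn' : (n : ℝ) ≠ 0 := by positivity
  set x : ℝ := lam * (t / n) with hx
  have hx0 : x ≠ 0 := by positivity
  have hx2 : 2 - x ≠ 0 := by linarith
  have hsum : ∑ k ∈ Finset.range n, ((1 - x) ^ (n - 1 - k) * σ) ^ 2 * (t / n)
      = σ ^ 2 * (t / n) * ∑ k ∈ Finset.range n, ((1 - x) ^ 2) ^ k := by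
    rw [Finset.mul_sum,
      ← Finset.sum_range_reflect (fun k => σ ^ 2 * (t / n) * ((1 - x) ^ 2) ^ k) n]
    refine Finset.sum_congr rfl fun k _ => ?_
    rw [← pow_mul, mul_comm 2, pow_mul]
    ring
  have hne : (1 - x) ^ 2 - 1 ≠ 0 := by
    rw [show (1 - x) ^ 2 - 1 = -(x * (2 - x)) by ring]
    exact neg_ne_zero.mpr (mul_ne_zero hx0 hx2)
  rw [hsum, geom_sum_eq (sub_ne_zero.mp hne), ← pow_mul, ← pow_mul, mul_comm n 2, ← mul_div_assoc,
    div_eq_div_iff (mul_ne_zero hlam.ne' hx2) hne]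
  have : lam * (t / n) = x := rfl
  linear_combination (-σ ^ 2 * ((1 - x) ^ (2 * n) - 1) * (2 - x)) * this

/-! ### Gaussian laws -/

/-- A linear combination of increments of a pre-Brownian motion along a monotone sequence of times
is centered Gaussian. -/
lemma ProbabilityTheory.IsPreBrownianReal.hasLaw_sum_mul_increments {Ω : Type*} [MeasurableSpace Ω]
    {P : Measure Ω} {W : ℝ≥0 → Ω → ℝ} (hW : IsPreBrownianReal W P)
    {τ : ℕ → ℝ≥0} (hτ : Monotone τ) (c : ℕ → ℝ) (n : ℕ) :
    HasLaw (fun ω => ∑ k ∈ Finset.range n, c k * (W (τ (k + 1)) ω - W (τ k) ω))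
      (gaussianReal 0 (∑ k ∈ Finset.range n, (c k ^ 2).toNNReal * (τ (k + 1) - τ k))) P := by
  have := hW.isGaussianProcess.isProbabilityMeasure
  have hlaw : ∀ k, HasLaw (fun ω => c k * (W (τ (k + 1)) ω - W (τ k) ω))
      (gaussianReal 0 ((c k ^ 2).toNNReal * (τ (k + 1) - τ k))) P := by
    intro k
    have h := gaussianReal_const_mul (hW.hasLaw_sub (τ (k + 1)) (τ k)) (c k)
    convert! h using 2
    · simp
    · ext
      have hk : (τ k : ℝ) ≤ τ (k + 1) := by exact_mod_cast hτ k.le_succ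
      simp [NNReal.coe_sub (hτ k.le_succ), Real.dist_eq, abs_of_nonneg (sub_nonneg.mpr hk),
        Real.toNNReal_of_nonneg (sq_nonneg (c k))]
  have hind : iIndepFun (fun k ω => c k * (W (τ (k + 1)) ω - W (τ k) ω)) P :=
    (hW.hasIndepIncrements.nat hτ).comp (fun k x => c k * x) (fun k => by fun_prop)
  refine ⟨Finset.aemeasurable_fun_sum _ fun k _ => (hlaw k).aemeasurable, ?_⟩
  refine Measure.ext_of_charFun ?_
  rw [iIndepFun.charFun_map_fun_finsetSum_eq_prod (fun k _ => (hlaw k).aemeasurable)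
    (hind.restrict _)]
  ext u
  rw [Finset.prod_apply]
  simp_rw [(hlaw _).map_eq, charFun_gaussianReal]
  rw [← Complex.exp_sum]
  congr 1
  push_cast
  simp [Finset.sum_mul, Finset.sum_div]

/-- An almost sure limit of centered Gaussian random variables whose variances converge is centered
Gaussian. -/
lemma hasLaw_gaussianReal_of_tendsto_ae {Ω : Type*} [MeasurableSpace Ω]
    {P : Measure Ω} [IsProbabilityMeasure P] {Y : ℕ → Ω → ℝ} {Z : Ω → ℝ} {v : ℕ → ℝ≥0} {v' : ℝ≥0}
    (hY : ∀ n, HasLaw (Y n) (gaussianReal 0 (v n)) P)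
    (hv : Filter.Tendsto v Filter.atTop (nhds v'))
    (hYZ : ∀ᵐ ω ∂P, Filter.Tendsto (fun n => Y n ω) Filter.atTop (nhds (Z ω))) :
    HasLaw Z (gaussianReal 0 v') P := by
  have hZ : AEMeasurable Z P :=
    aemeasurable_of_tendsto_metrizable_ae _ (fun n => (hY n).aemeasurable) hYZ
  refine ⟨hZ, ?_⟩
  have := Measure.isProbabilityMeasure_map hZ
  refine Measure.ext_of_charFun ?_
  ext u
  have hchar : ∀ {U : Ω → ℝ}, AEMeasurable U P →
      charFun (P.map U) u = ∫ ω, Complex.exp (u * U ω * Complex.I) ∂P := fun hU => by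
    rw [charFun_apply_real, integral_map hU (by fun_prop)]
  have h1 : Filter.Tendsto (fun n => charFun (P.map (Y n)) u) Filter.atTop
      (nhds (charFun (P.map Z) u)) := by
    simp_rw [hchar hZ, hchar (hY _).aemeasurable]
    refine tendsto_integral_of_dominated_convergence (fun _ => (1 : ℝ)) (fun n => ?_)
      (integrable_const _) (fun n => ?_) ?_
    · have := (hY n).aemeasurable
      exact AEMeasurable.aestronglyMeasurable (by fun_prop)
    · refine Filter.Eventually.of_forall fun ω => le_of_eq ?_
      rw [← Complex.ofReal_mul, Complex.norm_exp_ofReal_mul_I]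
    · filter_upwards [hYZ] with ω hω
      have hcont : Continuous fun x : ℝ => Complex.exp (u * x * Complex.I) := by fun_prop
      exact (hcont.tendsto _).comp hω
  refine tendsto_nhds_unique h1 ?_
  simp_rw [(hY _).map_eq, charFun_gaussianReal]
  have hcont : Continuous fun x : ℝ≥0 =>
      Complex.exp (u * (0 : ℝ) * Complex.I - x * u ^ 2 / 2) := by fun_prop
  exact (hcont.tendsto _).comp hv

/-- The one-dimensional marginals of the Ornstein–Uhlenbeck process. -/
lemma IsCenteredOrnsteinUhlenbeck.hasLaw_eval {Ω : Type*} [MeasurableSpace Ω] {P : Measure Ω}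
    [IsProbabilityMeasure P] {lam σ T : ℝ} (hlam : 0 < lam)
    {W : ℝ≥0 → Ω → ℝ} {X : ℝ → Ω → ℝ} (hX : IsCenteredOrnsteinUhlenbeck lam σ T W X P)
    {t : ℝ} (ht : t ∈ Set.Ioc (0 : ℝ) T) :
    HasLaw (X t)
      (gaussianReal 0 (σ ^ 2 * (1 - Real.exp (-2 * lam * t)) / (2 * lam)).toNNReal) P := by
  have htpos : 0 < t := ht.1
  have hmono : ∀ n : ℕ, Monotone fun k : ℕ => ((k : ℝ) * (t / n)).toNNReal := fun n i j hij =>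
    Real.toNNReal_le_toNNReal (by gcongr)
  refine hasLaw_gaussianReal_of_tendsto_ae
    (fun n => hX.isBrownian.toIsPreBrownianReal.hasLaw_sum_mul_increments (hmono n)
      (fun k => (1 - lam * (t / n)) ^ (n - 1 - k) * σ) n) ?_ ?_
  · refine ((continuous_real_toNNReal.tendsto _).comp
      (tendsto_euler_variance (σ := σ) (t := t) hlam)).congr fun n => ?_
    rw [Function.comp_apply, Real.toNNReal_sum_of_nonneg (fun k _ => by positivity)]
    refine Finset.sum_congr rfl fun k _ => ?_
    rw [Real.toNNReal_mul (sq_nonneg _)]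
    congr 1
    ext
    rw [NNReal.coe_sub (hmono n k.le_succ), Real.coe_toNNReal _ (by positivity),
      Real.coe_toNNReal _ (by positivity), Real.coe_toNNReal _ (by positivity)]
    push_cast
    ring
  · filter_upwards [hX.initial, hX.continuousOn, hX.sde] with ω h0 hc hs
    exact tendsto_euler_of_langevin (w := fun s => W s.toNNReal ω) hlam hc h0 hs ht

/-! ### Gaussian probabilities and the error function -/

/-- The distribution function of a centered Gaussian measure. The half-line `Iic b` differs from
`Iic 0` by the interval between `0` and `b`, on which the density is rescaled to `exp (-s²)`. -/
lemma gaussianReal_real_Iic {v : ℝ≥0} (hv : v ≠ 0) (b : ℝ) :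
    (gaussianReal 0 v).real (Set.Iic b) = 1 / 2 * (1 + erf (b / Real.sqrt (2 * v))) := by
  have hv' : (0 : ℝ) < v := by positivity
  set r : ℝ := Real.sqrt (2 * v) with hr
  have hrpos : 0 < r := by positivity
  have hr2 : r ^ 2 = 2 * v := Real.sq_sqrt (by positivity)
  have hsqrt : Real.sqrt (2 * Real.pi * v) = Real.sqrt Real.pi * r := by
    rw [hr, ← Real.sqrt_mul Real.pi_pos.le]
    congr 1
    ring
  have hpdf : ∀ x, gaussianPDFReal 0 v x
      = (Real.sqrt Real.pi * r)⁻¹ * Real.exp (-(x / r) ^ 2) := by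
    intro x
    rw [gaussianPDFReal, hsqrt, sub_zero, div_pow, hr2, neg_div]
  have hint := integrable_gaussianPDFReal 0 v
  have hreal : (gaussianReal 0 v).real (Set.Iic b)
      = ∫ x in Set.Iic b, gaussianPDFReal 0 v x := by
    rw [measureReal_def, gaussianReal_apply_eq_integral 0 hv, ENNReal.toReal_ofReal]
    exact integral_nonneg fun x => gaussianPDFReal_nonneg 0 v x
  have hhalf : ∫ x in Set.Iic (0 : ℝ), gaussianPDFReal 0 v x = 1 / 2 := by
    have heven : ∫ x in Set.Iic (0 : ℝ), gaussianPDFReal 0 v x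
        = ∫ x in Set.Ioi (0 : ℝ), gaussianPDFReal 0 v x := by
      have h := integral_comp_neg_Iic (0 : ℝ) (gaussianPDFReal 0 v)
      rw [neg_zero] at h
      rw [← h]
      refine integral_congr_ae (Filter.Eventually.of_forall fun x => ?_)
      simp [hpdf, neg_div]
    have htot := integral_gaussianPDFReal_eq_one 0 hv
    rw [← intervalIntegral.integral_Iic_add_Ioi (b := 0) hint.integrableOn hint.integrableOn,
      ← heven] at htot
    linarith
  have hdiff : (∫ x in Set.Iic b, gaussianPDFReal 0 v x)
      - ∫ x in Set.Iic (0 : ℝ), gaussianPDFReal 0 v x = ∫ x in (0 : ℝ)..b, gaussianPDFReal 0 v x :=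
    intervalIntegral.integral_Iic_sub_Iic hint.integrableOn hint.integrableOn
  have hscale : ∫ x in (0 : ℝ)..b, gaussianPDFReal 0 v x
      = (Real.sqrt Real.pi)⁻¹ * ∫ s in (0 : ℝ)..(b / r), Real.exp (-s ^ 2) := by
    simp_rw [hpdf]
    rw [intervalIntegral.integral_const_mul,
      intervalIntegral.integral_comp_div (fun s => Real.exp (-s ^ 2)) hrpos.ne', zero_div,
      smul_eq_mul, mul_inv]
    field_simp
  rw [hreal, eq_add_of_sub_eq hdiff, hhalf, hscale, erf]
  ring

/-- The distribution function of a centered Gaussian measure at an extended real `b`. The factors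
`c` and `d` split the normalization `1 / √(2v)`. -/
lemma gaussianReal_real_setOf_coe_le {v : ℝ≥0} (hv : v ≠ 0) {c d : ℝ} (hc : 0 < c) (hd : 0 < d)
    (hcd : c / d = 1 / Real.sqrt (2 * v)) (b : EReal) :
    (gaussianReal 0 v).real {x : ℝ | (x : EReal) ≤ b}
      = 1 / 2 * (1 + erfExt ((c : EReal) * b / (d : ℝ))) := by
  have hd' : (0 : EReal) < (d : EReal) := by exact_mod_cast hd
  induction b using EReal.rec with
  | bot =>
    rw [EReal.coe_mul_bot_of_pos hc, EReal.bot_div_of_pos_ne_top hd' (EReal.coe_ne_top d)]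
    simp [erfExt]
  | top =>
    rw [EReal.coe_mul_top_of_pos hc, EReal.top_div_of_pos_ne_top hd' (EReal.coe_ne_top d)]
    simp [erfExt]
    norm_num
  | coe b =>
    have hset : {x : ℝ | (x : EReal) ≤ (b : EReal)} = Set.Iic b := by ext; simp
    have hval : (c : EReal) * b / (d : ℝ) = ((b / Real.sqrt (2 * v) : ℝ) : EReal) := by
      rw [← EReal.coe_mul, ← EReal.coe_div]
      congr 1
      rw [mul_div_right_comm, hcd]
      ring
    rw [hset, hval, gaussianReal_real_Iic hv]
    simp only [erfExt, EReal.coe_ne_top, EReal.coe_ne_bot, if_false, EReal.toReal_coe]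

lemma measurableSet_realInterval (a b : EReal) : MeasurableSet (realInterval a b) :=
  (measurableSet_le measurable_const measurable_coe_real_ereal).inter
    (measurableSet_le measurable_coe_real_ereal measurable_const)

/-- The mass of an interval under a centered Gaussian measure. -/
lemma gaussianReal_real_realInterval {v : ℝ≥0} (hv : v ≠ 0) {c d : ℝ} (hc : 0 < c) (hd : 0 < d)
    (hcd : c / d = 1 / Real.sqrt (2 * v)) {a b : EReal} (hab : a ≤ b) :
    (gaussianReal 0 v).real (realInterval a b)
      = 1 / 2 * (erfExt ((c : EReal) * b / (d : ℝ)) - erfExt ((c : EReal) * a / (d : ℝ))) := by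
  have := nullSingletonClass_gaussianReal (μ := 0) hv
  let U : EReal → Set ℝ := fun e => {x : ℝ | (x : EReal) ≤ e}
  have hmeas : ∀ e, MeasurableSet (U e) := fun e =>
    measurableSet_le measurable_coe_real_ereal measurable_const
  -- The left endpoint carries no mass, so it may be dropped.
  have hae : realInterval a b =ᵐ[gaussianReal 0 v] (U b \ U a : Set ℝ) := by
    have hne : ∀ᵐ x ∂(gaussianReal 0 v), x ≠ a.toReal := by
      simp [ae_iff]
    filter_upwards [hne] with x hx
    refine propext ⟨fun h => ⟨h.2, fun hxa => hx ?_⟩, fun h => ⟨(not_le.mp h.2).le, h.1⟩⟩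
    have : (x : EReal) = a := le_antisymm hxa h.1
    simp [← this]
  have hsub : U a ⊆ U b := fun x (hx : (x : EReal) ≤ a) => le_trans hx hab
  have hcdf : ∀ e, (gaussianReal 0 v).real (U e)
      = 1 / 2 * (1 + erfExt ((c : EReal) * e / (d : ℝ))) :=
    gaussianReal_real_setOf_coe_le hv hc hd hcd
  rw [measureReal_congr hae, measureReal_sdiff hsub (hmeas a), hcdf, hcdf]
  ring

/-! ### Joint measurability -/

/-- A process on `[0, T]` with almost surely continuous paths and measurable marginals is jointly
measurable up to a null set: it is the limit of the step processes `X (⌊n t⌋ / n)`. -/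
lemma aemeasurable_uncurry_of_continuousOn {Ω : Type*} [MeasurableSpace Ω] {P : Measure Ω}
    [SFinite P] {T : ℝ} {X : ℝ → Ω → ℝ} (hm : ∀ t ∈ Set.Icc (0 : ℝ) T, AEMeasurable (X t) P)
    (hc : ∀ᵐ ω ∂P, ContinuousOn (fun t => X t ω) (Set.Icc 0 T)) :
    AEMeasurable (Function.uncurry X) ((volume.restrict (Set.Ioc 0 T)).prod P) := by
  have hmod : ∀ t : ℝ, ∃ Z : Ω → ℝ, Measurable Z ∧ (t ∈ Set.Icc (0 : ℝ) T → X t =ᵐ[P] Z) := by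
    intro t
    by_cases ht : t ∈ Set.Icc (0 : ℝ) T
    · exact ⟨(hm t ht).mk, (hm t ht).measurable_mk, fun _ => (hm t ht).ae_eq_mk⟩
    · exact ⟨0, measurable_zero, fun h => absurd h ht⟩
  choose Z hZm hZ using hmod
  have hae : ∀ᵐ ω ∂P, ∀ n k : ℕ, (k / n : ℝ) ∈ Set.Icc (0 : ℝ) T →
      X (k / n) ω = Z (k / n) ω := by
    simp_rw [ae_all_iff]
    exact fun n k h => hZ _ h
  refine aemeasurable_of_tendsto_metrizable_ae (u := Filter.atTop)
    (f := fun (n : ℕ) (p : ℝ × Ω) => Z (⌊(n : ℝ) * p.1⌋₊ / n) p.2) (fun n => ?_) ?_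
  · have h : Measurable fun q : ℕ × Ω => Z (q.1 / n) q.2 :=
      measurable_from_prod_countable_right fun k => hZm (k / n)
    exact (h.comp (((Nat.measurable_floor.comp (measurable_const.mul measurable_fst))).prodMk
      measurable_snd)).aemeasurable
  · have h1 : ∀ᵐ p ∂((volume.restrict (Set.Ioc (0 : ℝ) T)).prod P), p.1 ∈ Set.Ioc (0 : ℝ) T :=
      Measure.quasiMeasurePreserving_fst.ae (ae_restrict_mem measurableSet_Ioc)
    filter_upwards [h1, Measure.quasiMeasurePreserving_snd.ae (hae.and hc)] with p hp' hp2
    have hp := Set.Ioc_subset_Icc_self hp'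
    have hlim : Filter.Tendsto (fun n : ℕ => (⌊(n : ℝ) * p.1⌋₊ / n : ℝ)) Filter.atTop
        (nhds p.1) := by
      simpa [mul_comm, Function.comp_def] using
        (tendsto_nat_floor_mul_div_atTop hp.1).comp tendsto_natCast_atTop_atTop
    have hgrid : ∀ n : ℕ, (⌊(n : ℝ) * p.1⌋₊ / n : ℝ) ∈ Set.Icc (0 : ℝ) T := by
      intro n
      refine ⟨by positivity, le_trans ?_ hp.2⟩
      refine div_le_of_le_mul₀ (by positivity) hp.1 ?_
      rw [mul_comm p.1]
      exact Nat.floor_le (mul_nonneg (by positivity) hp.1)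
    have hX : Filter.Tendsto (fun n : ℕ => X (⌊(n : ℝ) * p.1⌋₊ / n) p.2) Filter.atTop
        (nhds (X p.1 p.2)) :=
      (hp2.2 p.1 hp).tendsto.comp (tendsto_nhdsWithin_iff.mpr
        ⟨hlim, Filter.Eventually.of_forall hgrid⟩)
    exact hX.congr fun n => hp2.1 n _ (hgrid n)

/-! ### The expected occupation time -/

/-- The probability that the Ornstein–Uhlenbeck process lies in an interval at time `t`. -/
lemma IsCenteredOrnsteinUhlenbeck.integral_indicator_realInterval {Ω : Type*} [MeasurableSpace Ω]
    {P : Measure Ω} [IsProbabilityMeasure P] {lam σ T : ℝ} (hlam : 0 < lam) (hσ : 0 < σ)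
    {W : ℝ≥0 → Ω → ℝ} {X : ℝ → Ω → ℝ} (hX : IsCenteredOrnsteinUhlenbeck lam σ T W X P)
    {a b : EReal} (hab : a ≤ b) {α : ℝ} (hα : α = Real.sqrt lam / σ)
    {t : ℝ} (ht : t ∈ Set.Ioc (0 : ℝ) T) :
    ∫ ω, (realInterval a b).indicator (fun _ => (1 : ℝ)) (X t ω) ∂P =
      1 / 2 * (erfExt ((α : EReal) * b / (Real.sqrt (1 - Real.exp (-2 * lam * t)) : ℝ))
        - erfExt ((α : EReal) * a / (Real.sqrt (1 - Real.exp (-2 * lam * t)) : ℝ))) := by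
  set e : ℝ := 1 - Real.exp (-2 * lam * t) with he
  have hepos : 0 < e := by
    have : -2 * lam * t < 0 := by nlinarith [mul_pos hlam ht.1]
    rw [he, sub_pos]
    exact Real.exp_zero ▸ Real.exp_lt_exp.mpr this
  have hvpos : 0 < σ ^ 2 * e / (2 * lam) := by positivity
  have hnorm : α / Real.sqrt e
      = 1 / Real.sqrt (2 * ((σ ^ 2 * e / (2 * lam)).toNNReal : ℝ)) := by
    rw [Real.coe_toNNReal _ hvpos.le,
      show 2 * (σ ^ 2 * e / (2 * lam)) = σ ^ 2 * e / lam by field_simp,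
      Real.sqrt_div (by positivity), Real.sqrt_mul (sq_nonneg σ), Real.sqrt_sq hσ.le, hα]
    have := (Real.sqrt_pos.mpr hlam).ne'
    field_simp
  have hmeas := measurableSet_realInterval a b
  rw [← gaussianReal_real_realInterval (Real.toNNReal_pos.mpr hvpos).ne'
    (hα ▸ div_pos (Real.sqrt_pos.mpr hlam) hσ) (Real.sqrt_pos.mpr hepos) hnorm hab]
  exact ((hX.hasLaw_eval hlam ht).integral_comp
    (f := (realInterval a b).indicator fun _ => (1 : ℝ))
    ((measurable_const.indicator hmeas).aestronglyMeasurable)).trans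
      (integral_indicator_one hmeas)

/-- The expected occupation time of the centered Ornstein–Uhlenbeck process. The integrability
claims say that the occupation time, its expectation and the integral on the right-hand side
are well defined. -/
theorem mainTheorem1 {Ω : Type*} [MeasurableSpace Ω] (P : Measure Ω) [IsProbabilityMeasure P]
    (lam σ T : ℝ) (hlam : 0 < lam) (hσ : 0 < σ) (hT : 0 < T)
    (W : ℝ≥0 → Ω → ℝ) (X : ℝ → Ω → ℝ) (hX : IsCenteredOrnsteinUhlenbeck lam σ T W X P)
    (a b : EReal) (hab : a ≤ b) (α : ℝ) (hα : α = Real.sqrt lam / σ) :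
    (∀ᵐ ω ∂P, IntervalIntegrable
      (fun t => (realInterval a b).indicator (fun _ => (1 : ℝ)) (X t ω)) volume 0 T) ∧
    Integrable (occupationTime T a b X) P ∧
    IntervalIntegrable
      (fun t => erfExt ((α : EReal) * b / (Real.sqrt (1 - Real.exp (-2 * lam * t)) : ℝ))
        - erfExt ((α : EReal) * a / (Real.sqrt (1 - Real.exp (-2 * lam * t)) : ℝ))) volume 0 T ∧
    ∫ ω, occupationTime T a b X ω ∂P =
      1 / 2 * ∫ t in (0 : ℝ)..T,
        (erfExt ((α : EReal) * b / (Real.sqrt (1 - Real.exp (-2 * lam * t)) : ℝ))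
          - erfExt ((α : EReal) * a / (Real.sqrt (1 - Real.exp (-2 * lam * t)) : ℝ))) := by
  have hmarg : ∀ t ∈ Set.Icc (0 : ℝ) T, AEMeasurable (X t) P := by
    intro t ht
    rcases ht.1.eq_or_lt with rfl | hpos
    · exact (aemeasurable_const (b := (0 : ℝ))).congr (hX.initial.mono fun ω h => h.symm)
    · exact (hX.hasLaw_eval hlam ⟨hpos, ht.2⟩).aemeasurable
  have hjoint : Integrable
      (fun p : ℝ × Ω => (realInterval a b).indicator (fun _ => (1 : ℝ)) (X p.1 p.2))
      ((volume.restrict (Set.Ioc 0 T)).prod P) := by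
    refine Integrable.of_bound (C := 1) ?_ (Filter.Eventually.of_forall fun p => ?_)
    · exact ((measurable_const.indicator (measurableSet_realInterval a b)).comp_aemeasurable
        (aemeasurable_uncurry_of_continuousOn hmarg hX.continuousOn)).aestronglyMeasurable
    · exact (norm_indicator_le_norm_self _ _).trans (by simp)
  have hocc : occupationTime T a b X = fun ω => ∫ t in Set.Ioc 0 T,
      (realInterval a b).indicator (fun _ => (1 : ℝ)) (X t ω) :=
    funext fun ω => intervalIntegral.integral_of_le hT.le
  have hprob := fun t (ht : t ∈ Set.Ioc (0 : ℝ) T) =>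
    hX.integral_indicator_realInterval hlam hσ hab hα ht
  refine ⟨?_, ?_, ?_, ?_⟩
  · filter_upwards [hjoint.prod_left_ae] with ω hω
    exact (intervalIntegrable_iff_integrableOn_Ioc_of_le hT.le).mpr hω
  · rw [hocc]
    exact hjoint.integral_prod_right
  · rw [intervalIntegrable_iff_integrableOn_Ioc_of_le hT.le]
    refine IntegrableOn.congr_fun (hjoint.integral_prod_left.const_mul 2) (fun t ht => ?_)
      measurableSet_Ioc
    simp only [hprob t ht]
    ring
  · rw [hocc, ← integral_integral_swap hjoint, intervalIntegral.integral_of_le hT.le,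
      ← integral_const_mul]
    exact setIntegral_congr_fun measurableSet_Ioc hprob
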